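/- For a prime $q$ and $n\ge 1$, the online convolution problem with fixed vector $V\in[q]^n$, $[q]=\{0,\dots,q-1\}$, is to maintain a vector $A\in[q]^n$, starting from a given $A_0$, under an operation $\mathrm{next}(d)$, $d\in[q]$, which replaces $A$ by $(A[1],\dots,A[n-1],d)$ and returns $\sum_{i} A[i]V[i] \bmod q$ for the new $A$. In the cell-probe model with word size $w\ge 1$ the memory consists of (at most) $2^w$ cells of $w$ bits each (so a cell can hold the address of any cell), nothing outside the memory is remembered between operations, computation is free, and the running time is the number of cell reads and writes; the initial memory and the algorithm may depend on $V$ and $A_0$. **Theorem 2.** There is an absolute constant $c>0$ such that for every prime $q$, all integers $w,n\ge 1$ and every initial vector $A_0$ the following holds. Consider any cell-probe algorithm with $w$ bits per cell that, for every $V\in[q]^n$, answers correctly every sequence of $n$ next-operations. If $V$ and the stream $\Delta=(\Delta_0,\dots,\Delta_{n-1})$ are independent and uniform on $[q]^n$, then the expected total time for performing $\mathrm{next}(\Delta_0),\dots,\mathrm{next}(\Delta_{n-1})$ is at least $$c\,\frac{\delta}{w}\,n\log_2 n,\qquad \delta=\log_2 q .$$ The same holds for randomised algorithms that are correct with probability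 $1$ over their internal randomness, the expectation then being taken over that randomness as well. -/

import Mathlib

namespace OnlineConvolution

/-- The memory of a cell-probe machine with `w` bits per cell. A cell can hold the address of
every cell, so there are `2 ^ w` cells, addressed by `w`-bit words. -/
abbrev Memory (w : ℕ) : Type := BitVec w → BitVec w

/-- What the computing unit does during one operation: it repeatedly reads or writes a cell and
finally returns a value. Each step may depend in an arbitrary way (computation is free) on all the
words read so far during this operation. Nothing is remembered between operations. -/
inductive Program (w : ℕ) (α : Type) : Type
  | ret (a : α) : Program w α
  | read (addr : BitVec w) (cont : BitVec w → Program w α) : Program w α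
  | write (addr : BitVec w) (val : BitVec w) (cont : Program w α) : Program w α

namespace Program

/-- The value returned by a program started on a given memory. -/
def output {w : ℕ} {α : Type} : Program w α → Memory w → α
  | ret a, _ => a
  | read addr cont, mem => (cont (mem addr)).output mem
  | write addr val cont, mem => cont.output (Function.update mem addr val)

/-- The memory left behind by a program started on a given memory. -/
def finalMemory {w : ℕ} {α : Type} : Program w α → Memory w → Memory w
  | ret _, mem => mem
  | read addr cont, mem => (cont (mem addr)).finalMemory mem
  | write addr val cont, mem => cont.finalMemory (Function.update mem addr val)

/-- The number of cell probes (reads and writes) that a program makes on a given memory. -/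
def probes {w : ℕ} {α : Type} : Program w α → Memory w → ℕ
  | ret _, _ => 0
  | read addr cont, mem => (cont (mem addr)).probes mem + 1
  | write addr val cont, mem => cont.probes (Function.update mem addr val) + 1

end Program

/-- A deterministic cell-probe algorithm that supports the operation `next`: an initial memory, and
the program executed by `next d` for each `d`. -/
structure Algorithm (w q : ℕ) : Type where
  init : Memory w
  next : ZMod q → Program w (ZMod q)

namespace Algorithm

/-- The values returned on a list of successive `next`-operations, from a given memory. -/
def outputsFrom {w q : ℕ} (alg : Algorithm w q) : Memory w → List (ZMod q) → List (ZMod q)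
  | _, [] => []
  | mem, d :: ds =>
      (alg.next d).output mem :: alg.outputsFrom ((alg.next d).finalMemory mem) ds

/-- The total number of cell probes made on a list of successive `next`-operations, from a given
memory. -/
def probesFrom {w q : ℕ} (alg : Algorithm w q) : Memory w → List (ZMod q) → ℕ
  | _, [] => 0
  | mem, d :: ds =>
      (alg.next d).probes mem + alg.probesFrom ((alg.next d).finalMemory mem) ds

/-- The running time of the algorithm on the stream `Δ` of length `n`. -/
def time {w q n : ℕ} (alg : Algorithm w q) (Δ : Fin n → ZMod q) : ℕ :=
  alg.probesFrom alg.init (List.ofFn Δ)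

end Algorithm

/-- The vector `(A[1], …, A[n-1], d)`. -/
def push {q n : ℕ} (A : Fin n → ZMod q) (d : ZMod q) : Fin n → ZMod q :=
  fun i => if h : (i : ℕ) + 1 < n then A ⟨(i : ℕ) + 1, h⟩ else d

/-- The values that successive `next`-operations have to return: each one pushes its argument into
the current vector `A` and asks for the inner product (modulo `q`) with `V`. -/
def answers {q n : ℕ} (V : Fin n → ZMod q) : (Fin n → ZMod q) → List (ZMod q) → List (ZMod q)
  | _, [] => []
  | A, d :: ds => (∑ i, push A d i * V i) :: answers V (push A d) ds

/-- The algorithm solves the online convolution problem for the fixed vector `V`, starting with the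
vector `A₀`, on every stream of `n` numbers. -/
def Algorithm.Solves {w q n : ℕ} (alg : Algorithm w q) (V A₀ : Fin n → ZMod q) : Prop :=
  ∀ Δ : Fin n → ZMod q,
    alg.outputsFrom alg.init (List.ofFn Δ) = answers V A₀ (List.ofFn Δ)

/-- The expected running time, when the fixed vector `V` and the stream `Δ` are independent and
uniform on `[q]^n`, of a family of algorithms (`alg V` is the one used for the fixed vector `V`). -/
noncomputable def expectedTime {w q n : ℕ} [NeZero q]
    (alg : (Fin n → ZMod q) → Algorithm w q) : ℝ :=
  (∑ V : Fin n → ZMod q, ∑ Δ : Fin n → ZMod q, ((alg V).time Δ : ℝ)) /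
    ((q : ℝ) ^ n * (q : ℝ) ^ n)

end OnlineConvolution

/-! The proof is by information transfer. Split the time axis into dyadic blocks of length `2 * l`.
What the right half of a block learns about the left half must pass through cells that changed
during the left half and are read, still unaltered, in the right half; these form `transfer`. Each
read is charged to at most one block over all scales, so the transfers sum to at most the running
time (`sum_card_transfer_le`).

Fix the stream outside the left half. The transferred cells and their contents determine the answers
in the right half (`output_eq_of_transferCode_eq`), so two streams with equal codes differ by a
kernel vector of the Toeplitz map given by `V` (`Invisible`). For random `V` that kernel has fewer
than two elements on average (`sum_card_invisible`). Hence nearly all of the `q ^ l` left halves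
need different codes, and a code with `k` cells carries only `O(w * k)` bits. The expected transfer
is therefore of order `l * δ / w` per block, so `n * δ / w` per scale, and there are about `log₂ n`
scales. -/

namespace OnlineConvolution

/-! ### Locality of a single program -/

namespace Program

/-- The cells read by a program started on a given memory. -/
def readSet {w : ℕ} {α : Type} : Program w α → Memory w → Finset (BitVec w)
  | ret _, _ => ∅
  | read addr cont, mem => insert addr ((cont (mem addr)).readSet mem)
  | write addr val cont, mem => cont.readSet (Function.update mem addr val)

theorem card_readSet_le {w : ℕ} {α : Type} (p : Program w α) (mem : Memory w) :
    (p.readSet mem).card ≤ p.probes mem := by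
  induction p generalizing mem with
  | ret a => simp [readSet]
  | read addr cont ih =>
    exact (Finset.card_insert_le _ _).trans (Nat.succ_le_succ (ih _ _))
  | write addr val cont ih => exact (ih _).trans (Nat.le_succ _)

theorem output_eq_of_agree {w : ℕ} {α : Type} (p : Program w α) (m m' : Memory w)
    (h : ∀ c ∈ p.readSet m, m' c = m c) : p.output m' = p.output m := by
  induction p generalizing m m' with
  | ret a => rfl
  | read addr cont ih =>
    simp only [readSet, Finset.mem_insert, forall_eq_or_imp] at h
    simp only [output, h.1]
    exact ih _ _ _ h.2
  | write addr val cont ih =>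
    refine ih _ _ fun c hc => ?_
    rcases eq_or_ne c addr with rfl | hne
    · simp
    · simpa [hne] using h c hc

/-- Two runs of a program on memories that agree on the cells read agree on all the cells written. -/
theorem finalMemory_of_agree {w : ℕ} {α : Type} (p : Program w α) (m m' : Memory w)
    (h : ∀ c ∈ p.readSet m, m' c = m c) (c : BitVec w) :
    p.finalMemory m' c = p.finalMemory m c ∨
      (p.finalMemory m' c = m' c ∧ p.finalMemory m c = m c) := by
  induction p generalizing m m' with
  | ret a => exact Or.inr ⟨rfl, rfl⟩
  | read addr cont ih =>
    simp only [readSet, Finset.mem_insert, forall_eq_or_imp] at h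
    simp only [finalMemory, h.1]
    exact ih _ _ _ h.2
  | write addr val cont ih =>
    have h' : ∀ c ∈ cont.readSet (Function.update m addr val),
        Function.update m' addr val c = Function.update m addr val c := by
      intro c hc
      rcases eq_or_ne c addr with rfl | hne
      · simp
      · simpa [hne] using h c hc
    simp only [finalMemory]
    rcases ih _ _ h' with h1 | ⟨h1, h2⟩
    · exact Or.inl h1
    · rcases eq_or_ne c addr with rfl | hne
      · left; rw [h1, h2]; simp
      · right; rw [h1, h2]; simp [hne]

end Program

/-! ### Runs on a stream -/

namespace Algorithm

variable {w q : ℕ}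

/-- The memory before the `i`-th operation, when the stream `d` is processed from memory `mem`. -/
def run (alg : Algorithm w q) (mem : Memory w) (d : ℕ → ZMod q) : ℕ → Memory w
  | 0 => mem
  | i + 1 => (alg.next (d i)).finalMemory (alg.run mem d i)

theorem run_succ' (alg : Algorithm w q) (mem : Memory w) (d : ℕ → ZMod q) (i : ℕ) :
    alg.run mem d (i + 1) =
      alg.run ((alg.next (d 0)).finalMemory mem) (fun j => d (j + 1)) i := by
  induction i with
  | zero => rfl
  | succ i ih => rw [run, ih]; rfl

theorem run_congr (alg : Algorithm w q) (mem : Memory w) {d d' : ℕ → ZMod q} (i : ℕ)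
    (h : ∀ j < i, d j = d' j) : alg.run mem d i = alg.run mem d' i := by
  induction i with
  | zero => rfl
  | succ i ih =>
    rw [run, run, ih fun j hj => h j (by omega), h i (by omega)]

theorem probesFrom_ofFn (alg : Algorithm w q) (n : ℕ) (mem : Memory w) (d : ℕ → ZMod q) :
    alg.probesFrom mem (List.ofFn fun i : Fin n => d i) =
      ∑ i ∈ Finset.range n, (alg.next (d i)).probes (alg.run mem d i) := by
  induction n generalizing mem d with
  | zero => simp [probesFrom]
  | succ n ih =>
    rw [List.ofFn_succ, probesFrom, Finset.sum_range_succ', add_comm]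
    simp only [run_succ']
    exact congrArg₂ _ (ih _ fun j => d (j + 1)) rfl

theorem outputsFrom_ofFn (alg : Algorithm w q) (n : ℕ) (mem : Memory w) (d : ℕ → ZMod q) :
    alg.outputsFrom mem (List.ofFn fun i : Fin n => d i) =
      List.ofFn fun i : Fin n => (alg.next (d i)).output (alg.run mem d i) := by
  induction n generalizing mem d with
  | zero => simp [outputsFrom]
  | succ n ih =>
    rw [List.ofFn_succ, outputsFrom, List.ofFn_succ]
    refine congrArg₂ _ rfl ?_
    simp only [Fin.val_succ, run_succ']
    exact ih _ fun j => d (j + 1)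

end Algorithm

/-! ### The sliding vector and its dependence on the stream -/

/-- The vector after `i` operations. -/
def window {q n : ℕ} (A : Fin n → ZMod q) (d : ℕ → ZMod q) : ℕ → Fin n → ZMod q
  | 0 => A
  | i + 1 => push (window A d i) (d i)

theorem window_succ' {q n : ℕ} (A : Fin n → ZMod q) (d : ℕ → ZMod q) (i : ℕ) :
    window A d (i + 1) = window (push A (d 0)) (fun j => d (j + 1)) i := by
  induction i with
  | zero => rfl
  | succ i ih => rw [window, ih]; rfl

theorem answers_ofFn {q n : ℕ} (V : Fin n → ZMod q) (m : ℕ) (A : Fin n → ZMod q)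
    (d : ℕ → ZMod q) :
    answers V A (List.ofFn fun i : Fin m => d i) =
      List.ofFn fun i : Fin m => ∑ p, window A d (i + 1) p * V p := by
  induction m generalizing A d with
  | zero => simp [answers]
  | succ m ih =>
    rw [List.ofFn_succ, answers, List.ofFn_succ]
    refine congrArg₂ _ rfl ?_
    simp only [Fin.val_succ, fun i : ℕ => window_succ' A d (i + 1)]
    exact ih _ fun j => d (j + 1)

/-- The contribution of the stream to the vector after `i + 1` operations. -/
def shift {q n : ℕ} (d : ℕ → ZMod q) (i : ℕ) (p : Fin n) : ZMod q :=
  if (p : ℕ) + i + 1 < n then 0 else d (p + i + 1 - n)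

theorem window_apply {q n : ℕ} (A : Fin n → ZMod q) (d : ℕ → ZMod q) (i : ℕ) (p : Fin n) :
    window A d i p = if h : (p : ℕ) + i < n then A ⟨p + i, h⟩ else d (p + i - n) := by
  induction i generalizing p with
  | zero => simp [window]
  | succ i ih =>
    simp only [window, push]
    split_ifs with h1 h2 h2
    · rw [ih, dif_pos (by simp only; omega)]
      congr 2
      simp only
      omega
    · rw [ih, dif_neg (by simp only; omega)]
      congr 1
      simp only
      omega
    · omega
    · congr 1
      omega

/-- The initial vector cancels, so differences of answers are linear in the difference of the
streams. This is why the bound is uniform in `A₀`. -/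
theorem window_sub_window {q n : ℕ} (A : Fin n → ZMod q) (d d' : ℕ → ZMod q) (i : ℕ)
    (p : Fin n) :
    window A d (i + 1) p - window A d' (i + 1) p = shift (d - d') i p := by
  rw [window_apply, window_apply, shift, add_assoc]
  split_ifs <;> simp

/-- A finite sequence, continued by zeros. -/
def extend {q n : ℕ} (x : Fin n → ZMod q) (i : ℕ) : ZMod q :=
  if h : i < n then x ⟨i, h⟩ else 0

theorem extend_coe {q n : ℕ} (x : Fin n → ZMod q) (i : Fin n) : extend x i = x i := by
  simp [extend]

theorem extend_sub {q n : ℕ} (x y : Fin n → ZMod q) :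
    extend (x - y) = extend x - extend y := by
  funext i
  simp only [extend, Pi.sub_apply]
  split_ifs <;> simp

namespace Algorithm

variable {w q n : ℕ}

theorem time_eq (alg : Algorithm w q) (x : Fin n → ZMod q) :
    alg.time x = ∑ i ∈ Finset.range n,
      (alg.next (extend x i)).probes (alg.run alg.init (extend x) i) := by
  rw [← probesFrom_ofFn, time]
  simp only [extend_coe]

theorem Solves.output_eq {alg : Algorithm w q} {V A₀ : Fin n → ZMod q} (h : alg.Solves V A₀)
    (x : Fin n → ZMod q) {i : ℕ} (hi : i < n) :
    (alg.next (extend x i)).output (alg.run alg.init (extend x) i) =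
      ∑ p, window A₀ (extend x) (i + 1) p * V p := by
  have h1 := h x
  have hx : x = fun i : Fin n => extend x i := funext fun i => (extend_coe x i).symm
  have h2 : List.ofFn x = List.ofFn fun i : Fin n => extend x i := congrArg _ hx
  rw [h2, outputsFrom_ofFn, answers_ofFn] at h1
  exact congrFun (List.ofFn_injective h1) ⟨i, hi⟩

/-! ### Information transfer between neighbouring intervals -/

open Classical in
/-- The cells read by the `i`-th operation whose contents did not change from time `a + l` on, but
differ from those at time `a`. -/
noncomputable def transferAt (alg : Algorithm w q) (d : ℕ → ZMod q) (a l i : ℕ) :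
    Finset (BitVec w) :=
  {c ∈ (alg.next (d i)).readSet (alg.run alg.init d i) |
    alg.run alg.init d (a + l) c ≠ alg.run alg.init d a c ∧
      ∀ j, a + l ≤ j → j ≤ i → alg.run alg.init d j c = alg.run alg.init d (a + l) c}

/-- The cells that transfer information from the operations `a, …, a + l - 1` to the operations
`a + l, …, a + 2 * l - 1`. -/
noncomputable def transfer (alg : Algorithm w q) (d : ℕ → ZMod q) (a l : ℕ) :
    Finset (BitVec w) :=
  (Finset.Ico (a + l) (a + 2 * l)).biUnion (alg.transferAt d a l)

theorem mem_transferAt {alg : Algorithm w q} {d : ℕ → ZMod q} {a l i : ℕ} {c : BitVec w} :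
    c ∈ alg.transferAt d a l i ↔ c ∈ (alg.next (d i)).readSet (alg.run alg.init d i) ∧
      alg.run alg.init d (a + l) c ≠ alg.run alg.init d a c ∧
      ∀ j, a + l ≤ j → j ≤ i → alg.run alg.init d j c = alg.run alg.init d (a + l) c := by
  simp [transferAt]

/-- The transferred cells together with their contents. -/
noncomputable def transferCode (alg : Algorithm w q) (d : ℕ → ZMod q) (a l : ℕ) :
    Finset (BitVec w × BitVec w) :=
  (alg.transfer d a l).image fun c => (c, alg.run alg.init d (a + l) c)

theorem card_transferCode (alg : Algorithm w q) (d : ℕ → ZMod q) (a l : ℕ) :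
    (alg.transferCode d a l).card = (alg.transfer d a l).card :=
  Finset.card_image_of_injective _ fun _ _ h => congrArg Prod.fst h

open Classical in
/-- The memory at time `a`, with the transferred cells updated. -/
noncomputable def patched (alg : Algorithm w q) (d : ℕ → ZMod q) (a l : ℕ) : Memory w :=
  fun c => if c ∈ alg.transfer d a l then alg.run alg.init d (a + l) c
    else alg.run alg.init d a c

/-- A cell that is read and unchanged since time `a + l` either is transferred, so that patching
gave it the right content, or has the same content at times `a` and `a + l`. -/
theorem patched_agree (alg : Algorithm w q) (d : ℕ → ZMod q) (a l t : ℕ) (ht : t < l)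
    (h : ∀ c, alg.run (alg.patched d a l) (fun j => d (a + l + j)) t c =
        alg.run alg.init d (a + l + t) c ∨
      (alg.run (alg.patched d a l) (fun j => d (a + l + j)) t c = alg.patched d a l c ∧
        ∀ j, a + l ≤ j → j ≤ a + l + t →
          alg.run alg.init d j c = alg.run alg.init d (a + l) c))
    (c : BitVec w)
    (hc : c ∈ (alg.next (d (a + l + t))).readSet (alg.run alg.init d (a + l + t))) :
    alg.run (alg.patched d a l) (fun j => d (a + l + j)) t c =
      alg.run alg.init d (a + l + t) c := by
  rcases h c with h | ⟨h1, h2⟩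
  · exact h
  rw [h1, h2 _ (by omega) le_rfl, patched]
  split_ifs with hmem
  · rfl
  · by_contra hne
    refine hmem (Finset.mem_biUnion.2 ⟨a + l + t, Finset.mem_Ico.2 ⟨by omega, by omega⟩, ?_⟩)
    exact mem_transferAt.2 ⟨hc, fun he => hne he.symm, h2⟩

/-- The simulation from the patched memory may hold wrong contents, but only in cells that neither
run has altered since time `a + l`. Such cells are not read, by `patched_agree`, so the invariant
survives the next operation. -/
theorem patched_invariant (alg : Algorithm w q) (d : ℕ → ZMod q) (a l t : ℕ) (ht : t ≤ l)
    (c : BitVec w) :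
    alg.run (alg.patched d a l) (fun j => d (a + l + j)) t c =
        alg.run alg.init d (a + l + t) c ∨
      (alg.run (alg.patched d a l) (fun j => d (a + l + j)) t c = alg.patched d a l c ∧
        ∀ j, a + l ≤ j → j ≤ a + l + t →
          alg.run alg.init d j c = alg.run alg.init d (a + l) c) := by
  induction t generalizing c with
  | zero =>
    refine Or.inr ⟨rfl, fun j h1 h2 => ?_⟩
    rw [show j = a + l by omega]
  | succ t ih =>
    have hagree := alg.patched_agree d a l t (by omega) (ih (by omega))
    rcases Program.finalMemory_of_agree _ _ _ hagree c with h | ⟨h1, h2⟩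
    · exact Or.inl h
    · rcases ih (by omega) c with h3 | ⟨h3, h4⟩
      · exact Or.inl (h1.trans (h3.trans h2.symm))
      · refine Or.inr ⟨h1.trans h3, fun j hj1 hj2 => ?_⟩
        rcases Nat.lt_or_ge (a + l + t) j with hj | hj
        · rw [show j = a + l + t + 1 by omega]
          exact h2.trans (h4 _ (by omega) le_rfl)
        · exact h4 j hj1 hj

theorem output_patched (alg : Algorithm w q) (d : ℕ → ZMod q) (a l t : ℕ) (ht : t < l) :
    (alg.next (d (a + l + t))).output
        (alg.run (alg.patched d a l) (fun j => d (a + l + j)) t) =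
      (alg.next (d (a + l + t))).output (alg.run alg.init d (a + l + t)) :=
  Program.output_eq_of_agree _ _ _
    (alg.patched_agree d a l t ht (alg.patched_invariant d a l t ht.le))

theorem patched_congr (alg : Algorithm w q) {d d' : ℕ → ZMod q} {a l : ℕ}
    (hd : ∀ j < a, d j = d' j) (hcode : alg.transferCode d a l = alg.transferCode d' a l) :
    alg.patched d a l = alg.patched d' a l := by
  have key : ∀ {d d' : ℕ → ZMod q}, alg.transferCode d a l = alg.transferCode d' a l →
      ∀ c ∈ alg.transfer d a l, c ∈ alg.transfer d' a l ∧
        alg.run alg.init d (a + l) c = alg.run alg.init d' (a + l) c := by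
    intro d d' h c hc
    have h1 : (c, alg.run alg.init d (a + l) c) ∈ alg.transferCode d' a l :=
      h ▸ Finset.mem_image_of_mem _ hc
    obtain ⟨c', hc', he⟩ := Finset.mem_image.1 h1
    obtain ⟨rfl, h3⟩ := Prod.mk.inj he
    exact ⟨hc', h3.symm⟩
  funext c
  unfold patched
  by_cases h : c ∈ alg.transfer d a l
  · rw [if_pos h, if_pos (key hcode c h).1, (key hcode c h).2]
  · rw [if_neg h, if_neg fun h' => h (key hcode.symm c h').1, alg.run_congr _ _ hd]

/-- The transferred cells determine the later outputs. -/
theorem output_eq_of_transferCode_eq (alg : Algorithm w q) {d d' : ℕ → ZMod q} {a l : ℕ}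
    (hd : ∀ j, ¬ (a ≤ j ∧ j < a + l) → d j = d' j)
    (hcode : alg.transferCode d a l = alg.transferCode d' a l) {i : ℕ}
    (hi : a + l ≤ i) (hi' : i < a + 2 * l) :
    (alg.next (d i)).output (alg.run alg.init d i) =
      (alg.next (d' i)).output (alg.run alg.init d' i) := by
  obtain ⟨t, rfl⟩ := Nat.exists_eq_add_of_le hi
  have hd' : (fun j => d (a + l + j)) = fun j => d' (a + l + j) :=
    funext fun j => hd _ (by omega)
  rw [← output_patched _ _ _ _ _ (by omega), ← output_patched _ _ _ _ _ (by omega), hd',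
    alg.patched_congr (fun j hj => hd j (by omega)) hcode, hd (a + l + t) (by omega)]

/-- A read is charged to at most one pair of neighbouring dyadic intervals. -/
theorem dyadic_unique (alg : Algorithm w q) (d : ℕ → ZMod q) {k k' m m' i : ℕ} {c : BitVec w}
    (hk : k < k') (hi : m * (2 * 2 ^ k) + 2 ^ k ≤ i ∧ i < m * (2 * 2 ^ k) + 2 * 2 ^ k)
    (hi' : m' * (2 * 2 ^ k') + 2 ^ k' ≤ i)
    (hc : c ∈ alg.transferAt d (m * (2 * 2 ^ k)) (2 ^ k) i)
    (hc' : c ∈ alg.transferAt d (m' * (2 * 2 ^ k')) (2 ^ k') i) : False := by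
  obtain ⟨-, hne, -⟩ := mem_transferAt.1 hc
  obtain ⟨-, -, hconst⟩ := mem_transferAt.1 hc'
  -- By divisibility, the small block containing `i` lies inside the right half of the large one.
  -- There the cell is constant up to time `i`, so it cannot have changed during the small left
  -- half.
  obtain ⟨r, hr⟩ : 2 * 2 ^ k ∣ 2 ^ k' := by
    rw [← pow_succ']
    exact pow_dvd_pow 2 hk
  have hle : m' * (2 * 2 ^ k') + 2 ^ k' ≤ m * (2 * 2 ^ k) := by
    have e : m' * (2 * 2 ^ k') + 2 ^ k' = (m' * 2 * r + r) * (2 * 2 ^ k) := by rw [hr]; ring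
    have h1 : (m' * 2 * r + r) * (2 * 2 ^ k) < (m + 1) * (2 * 2 ^ k) := by
      rw [← e, add_mul, one_mul]
      omega
    rw [e]
    exact Nat.mul_le_mul_right _ (Nat.lt_succ_iff.1 (Nat.lt_of_mul_lt_mul_right h1))
  exact hne ((hconst _ (by omega) (by omega)).trans (hconst _ hle (by omega)).symm)

theorem sum_card_transfer_le (alg : Algorithm w q) (x : Fin n → ZMod q) (K : ℕ) :
    ∑ k ∈ Finset.range K, ∑ m ∈ Finset.range (n / (2 * 2 ^ k)),
      (alg.transfer (extend x) (m * (2 * 2 ^ k)) (2 ^ k)).card ≤ alg.time x := by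
  classical
  set d := extend x
  let I : Finset (Σ _ : ℕ, ℕ) :=
    (Finset.range K).sigma fun k => Finset.range (n / (2 * 2 ^ k))
  let S : (Σ _ : ℕ, ℕ) → Finset (Σ _ : ℕ, BitVec w) := fun s =>
    (Finset.Ico (s.2 * (2 * 2 ^ s.1) + 2 ^ s.1) (s.2 * (2 * 2 ^ s.1) + 2 * 2 ^ s.1)).sigma
      (alg.transferAt d (s.2 * (2 * 2 ^ s.1)) (2 ^ s.1))
  have hdisj : (I : Set (Σ _ : ℕ, ℕ)).PairwiseDisjoint S := by
    rintro ⟨k, m⟩ - ⟨k', m'⟩ - hne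
    refine Finset.disjoint_left.2 ?_
    rintro ⟨i, c⟩ h h'
    simp only [S, Finset.mem_sigma, Finset.mem_Ico] at h h'
    rcases lt_trichotomy k k' with hk | rfl | hk
    · exact alg.dyadic_unique d hk h.1 h'.1.1 h.2 h'.2
    · refine hne ?_
      have hpos : 0 < 2 * 2 ^ k := by positivity
      have e1 : i / (2 * 2 ^ k) = m :=
        Nat.div_eq_of_lt_le (by omega) (by rw [add_mul, one_mul]; omega)
      have e2 : i / (2 * 2 ^ k) = m' :=
        Nat.div_eq_of_lt_le (by omega) (by rw [add_mul, one_mul]; omega)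
      rw [← e1, ← e2]
    · exact alg.dyadic_unique d hk h'.1 h.1.1 h'.2 h.2
  calc ∑ k ∈ Finset.range K, ∑ m ∈ Finset.range (n / (2 * 2 ^ k)),
        (alg.transfer d (m * (2 * 2 ^ k)) (2 ^ k)).card
      = ∑ s ∈ I, (alg.transfer d (s.2 * (2 * 2 ^ s.1)) (2 ^ s.1)).card := by
        rw [Finset.sum_sigma]
    _ ≤ ∑ s ∈ I, (S s).card := by
        refine Finset.sum_le_sum fun s _ => ?_
        rw [Finset.card_sigma]
        exact Finset.card_biUnion_le
    _ = (I.biUnion S).card := (Finset.card_biUnion hdisj).symm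
    _ ≤ ((Finset.range n).sigma
          fun i => (alg.next (d i)).readSet (alg.run alg.init d i)).card := by
        refine Finset.card_le_card fun y hy => ?_
        obtain ⟨⟨k, m⟩, hs, hy⟩ := Finset.mem_biUnion.1 hy
        simp only [S, I, Finset.mem_sigma, Finset.mem_Ico, Finset.mem_range] at hy hs ⊢
        refine ⟨?_, (mem_transferAt.1 hy.2).1⟩
        have h1 : (m + 1) * (2 * 2 ^ k) ≤ n :=
          (Nat.mul_le_mul_right _ hs.2).trans (Nat.div_mul_le_self _ _)
        rw [add_mul, one_mul] at h1
        omega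
    _ ≤ alg.time x := by
        rw [Finset.card_sigma, time_eq]
        exact Finset.sum_le_sum fun i _ => Program.card_readSet_le _ _

end Algorithm

/-! ### Kernels of random Toeplitz matrices -/

theorem card_interval {n b l : ℕ} (h : b + l ≤ n) :
    Fintype.card {p : Fin n // b ≤ (p : ℕ) ∧ (p : ℕ) < b + l} = l := by
  have e : {p : Fin n // b ≤ (p : ℕ) ∧ (p : ℕ) < b + l} ≃ Fin l :=
    { toFun := fun p => ⟨p.1 - b, by have := p.2; omega⟩
      invFun := fun t => ⟨⟨b + t, by omega⟩, by simp⟩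
      left_inv := fun p => by
        have := p.2
        ext
        simp only
        omega
      right_inv := fun t => by simp }
  rw [Fintype.card_congr e, Fintype.card_fin]

theorem card_fun_off_interval {q n b l : ℕ} [NeZero q] (h : b + l ≤ n) :
    Fintype.card ({p : Fin n // ¬ (b ≤ (p : ℕ) ∧ (p : ℕ) < b + l)} → ZMod q) =
      q ^ (n - l) := by
  rw [Fintype.card_fun, ZMod.card, Fintype.card_subtype_compl, card_interval h,
    Fintype.card_fin]

/-- `y` is supported on `[a, a + l)`, and adding it to the stream does not change the answers in
`[a + l, a + 2 * l)`. -/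
def Invisible {q n : ℕ} (a l : ℕ) (V y : Fin n → ZMod q) : Prop :=
  (∀ p : Fin n, ¬ (a ≤ (p : ℕ) ∧ (p : ℕ) < a + l) → y p = 0) ∧
    ∀ i, a + l ≤ i → i < a + 2 * l → ∑ p, shift (extend y) i p * V p = 0

-- With `y s` the first nonzero entry of `y`, the `l` equations are triangular in `l` consecutive
-- entries of `V` with diagonal `y s`. The other `n - l` entries thus determine `V`.
open Classical in
theorem card_invisible_left {q n a l : ℕ} [Fact q.Prime] (h : a + 2 * l ≤ n)
    {y : Fin n → ZMod q} (hy : y ≠ 0) :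
    (Finset.univ.filter fun V : Fin n → ZMod q => Invisible a l V y).card ≤ q ^ (n - l) := by
  by_cases hsupp : ∀ p : Fin n, ¬ (a ≤ (p : ℕ) ∧ (p : ℕ) < a + l) → y p = 0
  swap
  · rw [Finset.filter_false_of_mem fun V _ hV => hsupp hV.1]
    simp
  have hex : ∃ j, extend y j ≠ 0 := by
    by_contra! hall
    exact hy (funext fun p => by rw [← extend_coe y p, hall]; rfl)
  set s := Nat.find hex
  have hs : extend y s ≠ 0 := Nat.find_spec hex
  have hmin : ∀ j < s, extend y j = 0 := fun j hj => not_not.1 (Nat.find_min hex hj)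
  have hsn : s < n := by
    by_contra hge
    exact hs (by rw [extend, dif_neg hge])
  have hsl : a ≤ s ∧ s < a + l := by
    by_contra hout
    exact hs (by rw [extend, dif_pos hsn]; exact hsupp ⟨s, hsn⟩ hout)
  -- At time `i` the entry `y s` meets `V p` for `p = s + n - 1 - i`; as `i` runs through `[a + l, a
  -- + 2 * l)`, `p` runs through `[b, b + l)`.
  set b := s + n - a - 2 * l
  have hbn : b + l ≤ n := by omega
  rw [← card_fun_off_interval (q := q) hbn, ← Finset.card_univ]
  refine Finset.card_le_card_of_injOn (fun V p => V p.1)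
    (fun _ _ => Finset.mem_coe.2 (Finset.mem_univ _)) ?_
  intro V hV V' hV' heq
  have hV := (Finset.mem_filter.1 (Finset.mem_coe.1 hV)).2.2
  have hV' := (Finset.mem_filter.1 (Finset.mem_coe.1 hV')).2.2
  -- Solve from large `p` downwards: entries beyond `p` already agree, and those before `p` meet
  -- entries of `y` before `s`, or entries of `A₀` that contribute zero.
  have key : ∀ t, ∀ p : Fin n, n - p = t → V p - V' p = 0 := by
    intro t
    induction t using Nat.strong_induction_on with
    | _ t ih =>
      intro p hp
      by_cases hpb : b ≤ (p : ℕ) ∧ (p : ℕ) < b + l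
      swap
      · exact sub_eq_zero.2 (congrFun heq ⟨p, hpb⟩)
      have hpn := p.2
      have h1 := hV (s + n - 1 - p) (by omega) (by omega)
      have h2 := hV' (s + n - 1 - p) (by omega) (by omega)
      have h3 : ∑ r, shift (extend y) (s + n - 1 - p) r * (V r - V' r) = 0 := by
        simp only [mul_sub, Finset.sum_sub_distrib, h1, h2, sub_zero]
      rw [Finset.sum_eq_single p] at h3
      · have h4 : shift (extend y) (s + n - 1 - p) p = extend y s := by
          rw [shift, if_neg (by omega)]
          congr 1
          omega
        rw [h4] at h3
        exact (mul_eq_zero.1 h3).resolve_left hs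
      · intro r _ hr
        have hr' : (r : ℕ) ≠ p := fun h => hr (Fin.ext h)
        have hrn := r.2
        rcases Nat.lt_or_ge p r with hlt | hge
        · rw [ih (n - r) (by omega) r rfl, mul_zero]
        · rw [shift]
          split_ifs
          · rw [zero_mul]
          · rw [hmin _ (by omega), zero_mul]
      · intro hp
        exact absurd (Finset.mem_univ _) hp
  exact funext fun p => sub_eq_zero.1 (key _ p rfl)

open Classical in
/-- A uniformly random Toeplitz matrix has fewer than two kernel vectors in expectation. -/
theorem sum_card_invisible {q n a l : ℕ} [Fact q.Prime] (h : a + 2 * l ≤ n) :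
    ∑ V : Fin n → ZMod q, (Finset.univ.filter (Invisible a l V)).card ≤
      q ^ (n - l) * (2 * q ^ l - 1) := by
  have hq : 0 < q := (Fact.out : q.Prime).pos
  let Y : Finset (Fin n → ZMod q) :=
    Finset.univ.filter fun y => ∀ p : Fin n, ¬ (a ≤ (p : ℕ) ∧ (p : ℕ) < a + l) → y p = 0
  have hY : Y.card ≤ q ^ l := by
    have hc : Fintype.card ({p : Fin n // a ≤ (p : ℕ) ∧ (p : ℕ) < a + l} → ZMod q) = q ^ l := by
      rw [Fintype.card_fun, ZMod.card, card_interval (by omega)]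
    rw [← hc, ← Finset.card_univ]
    refine Finset.card_le_card_of_injOn (fun y p => y p.1)
      (fun _ _ => Finset.mem_coe.2 (Finset.mem_univ _)) ?_
    intro y hy y' hy' heq
    funext p
    by_cases hp : a ≤ (p : ℕ) ∧ (p : ℕ) < a + l
    · exact congrFun heq ⟨p, hp⟩
    · rw [(Finset.mem_filter.1 (Finset.mem_coe.1 hy)).2 p hp,
        (Finset.mem_filter.1 (Finset.mem_coe.1 hy')).2 p hp]
  have h0 : (0 : Fin n → ZMod q) ∈ Y := by simp [Y]
  calc ∑ V : Fin n → ZMod q, (Finset.univ.filter (Invisible a l V)).card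
      = ∑ y : Fin n → ZMod q, (Finset.univ.filter fun V => Invisible a l V y).card :=
        Finset.sum_card_bipartiteAbove_eq_sum_card_bipartiteBelow _
    _ = ∑ y ∈ Y, (Finset.univ.filter fun V => Invisible a l V y).card := by
        refine (Finset.sum_subset (Finset.subset_univ _) fun y _ hy => ?_).symm
        rw [Finset.filter_false_of_mem, Finset.card_empty]
        exact fun V _ hV => hy (Finset.mem_filter.2 ⟨Finset.mem_univ _, hV.1⟩)
    _ ≤ q ^ n + (Y.card - 1) * q ^ (n - l) := by
        rw [← Finset.add_sum_erase _ _ h0, ← Finset.card_erase_of_mem h0, ← smul_eq_mul,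
          ← Finset.sum_const]
        refine add_le_add ?_ (Finset.sum_le_sum fun y hy =>
          card_invisible_left h (Finset.ne_of_mem_erase hy))
        refine (Finset.card_le_univ _).trans ?_
        rw [Fintype.card_fun, ZMod.card, Fintype.card_fin]
    _ ≤ q ^ (n - l) * (2 * q ^ l - 1) := by
        have e : q ^ n = q ^ (n - l) * q ^ l := by
          rw [← pow_add]
          congr 1
          omega
        have hl : 0 < q ^ l := by positivity
        rw [e, mul_comm (Y.card - 1), ← mul_add]
        exact Nat.mul_le_mul_left _ (by omega)

/-! ### Counting streams with a small transfer -/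

theorem card_finsets_le (α : Type*) [Fintype α] [DecidableEq α] (k : ℕ) :
    (Finset.univ.filter fun s : Finset α => s.card ≤ k).card ≤ (Fintype.card α + 1) ^ k := by
  induction k with
  | zero =>
    simp [Finset.card_eq_zero, Finset.filter_eq']
  | succ k ih =>
    have hsub : (Finset.univ.filter fun s : Finset α => s.card ≤ k + 1) ⊆
        ((Finset.univ.filter fun s : Finset α => s.card ≤ k) ×ˢ
          (Finset.univ : Finset (Option α))).image
            fun p => p.2.elim p.1 fun c => insert c p.1 := by
      intro s hs
      have hs := (Finset.mem_filter.1 hs).2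
      rw [Finset.mem_image]
      rcases s.eq_empty_or_nonempty with rfl | ⟨c, hc⟩
      · exact ⟨(∅, none), by simp, rfl⟩
      · refine ⟨(s.erase c, some c), ?_, Finset.insert_erase hc⟩
        have := Finset.card_erase_of_mem hc
        simp only [Finset.mem_product, Finset.mem_filter, Finset.mem_univ, true_and, and_true]
        omega
    refine (Finset.card_le_card hsub).trans (Finset.card_image_le.trans ?_)
    rw [Finset.card_product, Finset.card_univ, Fintype.card_option, pow_succ]
    exact Nat.mul_le_mul_right _ ih

namespace Algorithm

variable {w q n : ℕ}

-- Classify streams by their values off the left half and their transfer code. Subtracting a fixed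
-- member of a class embeds the class into the invisible vectors.
open Classical in
theorem card_transfer_le [Fact q.Prime] {alg : Algorithm w q} {V A₀ : Fin n → ZMod q}
    (hs : alg.Solves V A₀) {a l : ℕ} (h : a + 2 * l ≤ n) (k : ℕ) :
    (Finset.univ.filter fun x : Fin n → ZMod q =>
        (alg.transfer (extend x) a l).card ≤ k).card ≤
      (Finset.univ.filter (Invisible a l V)).card * (q ^ (n - l) * (4 ^ w + 1) ^ k) := by
  have hcodes : (Finset.univ.filter
      fun s : Finset (BitVec w × BitVec w) => s.card ≤ k).card ≤ (4 ^ w + 1) ^ k := by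
    refine (card_finsets_le _ k).trans (le_of_eq ?_)
    have hb : Fintype.card (BitVec w) = 2 ^ w := by
      rw [Fintype.card_congr BitVec.equivFin.toEquiv, Fintype.card_fin]
    norm_num [Fintype.card_prod, hb, ← mul_pow]
  rw [← card_fun_off_interval (q := q) (show a + l ≤ n by omega), ← Finset.card_univ]
  refine le_trans ?_ (Nat.mul_le_mul_left _ (Nat.mul_le_mul_left _ hcodes))
  rw [← Finset.card_product]
  refine Finset.card_le_mul_card_image_of_maps_to
    (f := fun x => ((fun p => x p.1), alg.transferCode (extend x) a l)) ?_ _ ?_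
  · intro x hx
    simp only [Finset.mem_product, Finset.mem_univ, true_and, Finset.mem_filter,
      card_transferCode] at hx ⊢
    exact hx
  · rintro ⟨o, γ⟩ -
    rcases Finset.eq_empty_or_nonempty ({x ∈ Finset.univ.filter fun x : Fin n → ZMod q =>
        (alg.transfer (extend x) a l).card ≤ k |
        ((fun p => x p.1), alg.transferCode (extend x) a l) = (o, γ)}) with he | ⟨z, hz⟩
    · rw [he]
      simp
    · have hz := Prod.mk.inj (Finset.mem_filter.1 hz).2
      refine Finset.card_le_card_of_injOn (fun x => x - z) ?_
        fun x _ y _ hxy => sub_left_injective hxy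
      intro x hx
      have hx := Prod.mk.inj (Finset.mem_filter.1 (Finset.mem_coe.1 hx)).2
      have hoff : ∀ p : Fin n, ¬ (a ≤ (p : ℕ) ∧ (p : ℕ) < a + l) → x p = z p :=
        fun p hp => congrFun (hx.1.trans hz.1.symm) ⟨p, hp⟩
      have hext : ∀ j, ¬ (a ≤ j ∧ j < a + l) → extend x j = extend z j := by
        intro j hj
        simp only [extend]
        split_ifs with hjn
        · exact hoff ⟨j, hjn⟩ hj
        · rfl
      refine Finset.mem_coe.2 (Finset.mem_filter.2 ⟨Finset.mem_univ _, fun p hp => ?_, ?_⟩)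
      · simp [hoff p hp]
      · intro i hi hi'
        have hout := alg.output_eq_of_transferCode_eq hext (hx.2.trans hz.2.symm) hi hi'
        rw [hs.output_eq x (by omega), hs.output_eq z (by omega), ← sub_eq_zero,
          ← Finset.sum_sub_distrib] at hout
        simp only [← sub_mul, window_sub_window] at hout
        rw [extend_sub]
        exact hout

end Algorithm

/-! ### Choice of the threshold and averaging -/

theorem exists_threshold {w Q : ℕ} (hw : 0 < w) (hQ : 2 ≤ Q) :
    ∃ k : ℕ, 4 * ((4 ^ w + 1) ^ k * (2 * Q - 1)) ≤ 3 * (Q * Q) ∧ Q ≤ 2 ^ (5 * w * (k + 1)) := by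
  have h8 : 1 < 8 ^ w := Nat.one_lt_pow hw.ne' (by norm_num)
  have h48 : 4 ^ w + 1 ≤ 8 ^ w := by
    have h2 : 2 ≤ 2 ^ w := by
      calc 2 = 2 ^ 1 := rfl
        _ ≤ 2 ^ w := Nat.pow_le_pow_right (by norm_num) hw
    have h4 : 1 ≤ 4 ^ w := Nat.one_le_pow _ _ (by norm_num)
    have e : 8 ^ w = 4 ^ w * 2 ^ w := by norm_num [← mul_pow]
    rw [e]
    nlinarith
  -- This is essentially the largest `k` with `(8 ^ w) ^ k ≤ Q / 4`, where `8 ^ w` replaces `4 ^ w +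
  -- 1`.
  refine ⟨Nat.log (8 ^ w) (Q / 4), ?_, ?_⟩
  · obtain ⟨r, rfl⟩ := Nat.exists_eq_add_of_le hQ
    have e : 2 * (2 + r) - 1 = 2 * r + 3 := by omega
    rw [e]
    rcases Nat.eq_zero_or_pos (Nat.log (8 ^ w) ((2 + r) / 4)) with h0 | hpos
    -- For `k = 0` the claim is `(3 * Q - 2) * (Q - 2) ≥ 0`, with equality at `Q = 2`; this is what
    -- forces the proportion `3 / 4`.
    · rw [h0]
      nlinarith
    · have h1 : (2 + r) / 4 ≠ 0 := by
        intro h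
        rw [h] at hpos
        simp at hpos
      have h2 := Nat.pow_log_le_self (8 ^ w) h1
      have h3 : (4 ^ w + 1) ^ Nat.log (8 ^ w) ((2 + r) / 4) ≤ (2 + r) / 4 :=
        (Nat.pow_le_pow_left h48 _).trans h2
      have h4 : 4 * (4 ^ w + 1) ^ Nat.log (8 ^ w) ((2 + r) / 4) ≤ 2 + r := by omega
      calc 4 * ((4 ^ w + 1) ^ Nat.log (8 ^ w) ((2 + r) / 4) * (2 * r + 3))
          = 4 * (4 ^ w + 1) ^ Nat.log (8 ^ w) ((2 + r) / 4) * (2 * r + 3) := by ring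
        _ ≤ (2 + r) * (2 * r + 3) := Nat.mul_le_mul_right _ h4
        _ ≤ 3 * ((2 + r) * (2 + r)) := by nlinarith
  · have h1 := Nat.lt_pow_succ_log_self h8 (Q / 4)
    set k := Nat.log (8 ^ w) (Q / 4)
    have h2 : Q ≤ 4 * (8 ^ w) ^ (k + 1) := by
      rw [mul_comm]
      exact ((Nat.div_lt_iff_lt_mul (by norm_num)).1 h1).le
    refine h2.trans ?_
    rw [show (8 : ℕ) = 2 ^ 3 by norm_num, show (4 : ℕ) = 2 ^ 2 by norm_num, ← pow_mul, ← pow_mul,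
      ← pow_add]
    refine Nat.pow_le_pow_right (by norm_num) ?_
    have : 1 ≤ w * (k + 1) := Nat.mul_pos hw (Nat.succ_pos k)
    nlinarith

/-- At most `3 / 4` of the pairs `(V, x)` have transfer at most `k`, so the mean is at least `(k +
1) / 4`; the factor `5 * w` from `exists_threshold` then gives `20 * w`. -/
theorem le_sum_card_transfer {w q n a l : ℕ} [Fact q.Prime] (hw : 0 < w) (hl : 0 < l)
    (h : a + 2 * l ≤ n) {A₀ : Fin n → ZMod q} {alg : (Fin n → ZMod q) → Algorithm w q}
    (hs : ∀ V, (alg V).Solves V A₀) :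
    (q : ℝ) ^ n * (q : ℝ) ^ n * (Real.logb 2 q * l / (20 * w)) ≤
      ∑ V : Fin n → ZMod q, ∑ x : Fin n → ZMod q,
        (((alg V).transfer (extend x) a l).card : ℝ) := by
  classical
  have hq := (Fact.out : q.Prime)
  have hQ : 2 ≤ q ^ l := hq.two_le.trans (Nat.le_self_pow hl.ne' q)
  obtain ⟨k, hk1, hk2⟩ := exists_threshold hw hQ
  have hcard : Fintype.card (Fin n → ZMod q) = q ^ n := by
    rw [Fintype.card_fun, ZMod.card, Fintype.card_fin]
  have e : q ^ n = q ^ (n - l) * q ^ l := by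
    rw [← pow_add]
    congr 1
    omega
  have hsmall : 4 * ∑ V : Fin n → ZMod q, (Finset.univ.filter fun x : Fin n → ZMod q =>
      ((alg V).transfer (extend x) a l).card ≤ k).card ≤ 3 * (q ^ n * q ^ n) := by
    calc 4 * ∑ V : Fin n → ZMod q, (Finset.univ.filter fun x : Fin n → ZMod q =>
          ((alg V).transfer (extend x) a l).card ≤ k).card
        ≤ 4 * ∑ V : Fin n → ZMod q, (Finset.univ.filter (Invisible a l V)).card *
            (q ^ (n - l) * (4 ^ w + 1) ^ k) :=
          Nat.mul_le_mul_left _ (Finset.sum_le_sum fun V _ =>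
            Algorithm.card_transfer_le (hs V) h k)
      _ ≤ 4 * (q ^ (n - l) * (2 * q ^ l - 1) * (q ^ (n - l) * (4 ^ w + 1) ^ k)) := by
          rw [← Finset.sum_mul]
          exact Nat.mul_le_mul_left _ (Nat.mul_le_mul_right _ (sum_card_invisible h))
      _ = q ^ (n - l) * q ^ (n - l) * (4 * ((4 ^ w + 1) ^ k * (2 * q ^ l - 1))) := by ring
      _ ≤ q ^ (n - l) * q ^ (n - l) * (3 * (q ^ l * q ^ l)) := Nat.mul_le_mul_left _ hk1
      _ = 3 * (q ^ n * q ^ n) := by rw [e]; ring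
  have hmarkov : (k + 1) * (q ^ n * q ^ n) ≤
      ∑ V : Fin n → ZMod q, ∑ x : Fin n → ZMod q, ((alg V).transfer (extend x) a l).card +
        (k + 1) * ∑ V : Fin n → ZMod q, (Finset.univ.filter fun x : Fin n → ZMod q =>
          ((alg V).transfer (extend x) a l).card ≤ k).card := by
    have hc : (k + 1) * (q ^ n * q ^ n) =
        ∑ _V : Fin n → ZMod q, ∑ _x : Fin n → ZMod q, (k + 1) := by
      simp only [Finset.sum_const, Finset.card_univ, hcard, smul_eq_mul]
      ring
    rw [hc, Finset.mul_sum, ← Finset.sum_add_distrib]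
    refine Finset.sum_le_sum fun V _ => ?_
    rw [Finset.card_filter, Finset.mul_sum, ← Finset.sum_add_distrib]
    refine Finset.sum_le_sum fun x _ => ?_
    split_ifs <;> omega
  have hnat : (k + 1) * (q ^ n * q ^ n) ≤ 4 * ∑ V : Fin n → ZMod q, ∑ x : Fin n → ZMod q,
      ((alg V).transfer (extend x) a l).card := by
    nlinarith
  have hlog : Real.logb 2 q * l ≤ 5 * w * (k + 1) := by
    have h1 : ((q : ℝ) ^ l) ≤ 2 ^ (5 * w * (k + 1)) := by exact_mod_cast hk2
    have hqpos : (0 : ℝ) < q := by exact_mod_cast hq.pos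
    have h2 := Real.logb_le_logb_of_le (b := 2) (by norm_num) (by positivity) h1
    rw [Real.logb_pow, Real.logb_pow, Real.logb_self_eq_one (by norm_num)] at h2
    push_cast at h2
    linarith
  have hreal : ((k : ℝ) + 1) * ((q : ℝ) ^ n * (q : ℝ) ^ n) ≤
      4 * ∑ V : Fin n → ZMod q, ∑ x : Fin n → ZMod q,
        (((alg V).transfer (extend x) a l).card : ℝ) := by exact_mod_cast hnat
  have hwpos : (0 : ℝ) < w := by exact_mod_cast hw
  have hfrac : Real.logb 2 q * l / (20 * w) ≤ (k + 1) / 4 := by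
    rw [div_le_div_iff₀ (by positivity) (by norm_num)]
    linarith
  calc (q : ℝ) ^ n * (q : ℝ) ^ n * (Real.logb 2 q * l / (20 * w))
      ≤ (q : ℝ) ^ n * (q : ℝ) ^ n * ((k + 1) / 4) :=
        mul_le_mul_of_nonneg_left hfrac (by positivity)
    _ ≤ _ := by linarith

theorem expectedTime_ge {w q n : ℕ} [Fact q.Prime] (hw : 0 < w) (hn : 0 < n)
    {A₀ : Fin n → ZMod q} {alg : (Fin n → ZMod q) → Algorithm w q}
    (hs : ∀ V, (alg V).Solves V A₀) :
    1 / 160 * (Real.logb 2 q / w * (n * Real.logb 2 n)) ≤ expectedTime alg := by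
  have hq := (Fact.out : q.Prime)
  have hqpos : (0 : ℝ) < q := by exact_mod_cast hq.pos
  have hwpos : (0 : ℝ) < w := by exact_mod_cast hw
  have hδ : 0 ≤ Real.logb 2 q :=
    Real.logb_nonneg (by norm_num) (by exact_mod_cast hq.one_lt.le)
  set N : ℝ := (q : ℝ) ^ n * (q : ℝ) ^ n with hN
  have hNpos : 0 < N := by positivity
  rw [expectedTime, le_div_iff₀ hNpos]
  set K := Nat.log 2 n with hK
  -- Rounding down the logarithm costs a factor of two, which turns `80` into `160`. For `n = 1`
  -- both sides vanish.
  have hlogn : Real.logb 2 n ≤ 2 * K := by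
    rcases Nat.lt_or_ge n 2 with h1 | h2
    · rw [show n = 1 by omega]
      simp
    · have hK1 : 1 ≤ K := Nat.log_pos (by norm_num) h2
      have h3 : (n : ℝ) ≤ 2 ^ (K + 1) := by
        exact_mod_cast (Nat.lt_pow_succ_log_self (by norm_num) n).le
      have h4 := Real.logb_le_logb_of_le (b := 2) (by norm_num) (by exact_mod_cast hn) h3
      rw [Real.logb_pow, Real.logb_self_eq_one (by norm_num)] at h4
      have hK1' : (1 : ℝ) ≤ K := by exact_mod_cast hK1
      push_cast at h4
      linarith
  have hlevel : ∀ k ∈ Finset.range K,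
      N * (Real.logb 2 q * n / (80 * w)) ≤ ∑ m ∈ Finset.range (n / (2 * 2 ^ k)),
        ∑ V : Fin n → ZMod q, ∑ x : Fin n → ZMod q,
          (((alg V).transfer (extend x) (m * (2 * 2 ^ k)) (2 ^ k)).card : ℝ) := by
    intro k hk
    have hkn : 2 * 2 ^ k ≤ n := by
      rw [← pow_succ']
      exact (Nat.pow_le_pow_right (by norm_num) (Finset.mem_range.1 hk)).trans
        (Nat.pow_log_le_self 2 hn.ne')
    -- Complete blocks cover at least half of the time axis, which turns `20` into `80` together
    -- with the block length `2 * l`.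
    have hhalf : n ≤ n / (2 * 2 ^ k) * (4 * 2 ^ k) := by
      have hpos : 0 < 2 * 2 ^ k := by positivity
      have h1 : 1 ≤ n / (2 * 2 ^ k) := (Nat.one_le_div_iff hpos).2 hkn
      have h2 := Nat.lt_div_mul_add (a := n) hpos
      nlinarith
    have hhalf' : (n : ℝ) ≤ (n / (2 * 2 ^ k) : ℕ) * (4 * 2 ^ k) := by exact_mod_cast hhalf
    calc N * (Real.logb 2 q * n / (80 * w))
        ≤ N * (Real.logb 2 q * ((n / (2 * 2 ^ k) : ℕ) * (4 * 2 ^ k)) / (80 * w)) := by gcongr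
      _ = ∑ _m ∈ Finset.range (n / (2 * 2 ^ k)),
            N * (Real.logb 2 q * (2 ^ k : ℕ) / (20 * w)) := by
          rw [Finset.sum_const, Finset.card_range, nsmul_eq_mul]
          push_cast
          field_simp
          ring
      _ ≤ _ := by
          refine Finset.sum_le_sum fun m hm => ?_
          refine le_sum_card_transfer hw (by positivity) ?_ hs
          have h1 : (m + 1) * (2 * 2 ^ k) ≤ n :=
            (Nat.mul_le_mul_right _ (Finset.mem_range.1 hm)).trans (Nat.div_mul_le_self _ _)
          rwa [add_mul, one_mul] at h1
  calc 1 / 160 * (Real.logb 2 q / w * (n * Real.logb 2 n)) * N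
      ≤ 1 / 160 * (Real.logb 2 q / w * (n * (2 * K))) * N := by gcongr
    _ = ∑ _k ∈ Finset.range K, N * (Real.logb 2 q * n / (80 * w)) := by
        rw [Finset.sum_const, Finset.card_range, nsmul_eq_mul]
        field_simp
        ring
    _ ≤ ∑ k ∈ Finset.range K, ∑ m ∈ Finset.range (n / (2 * 2 ^ k)),
        ∑ V : Fin n → ZMod q, ∑ x : Fin n → ZMod q,
          (((alg V).transfer (extend x) (m * (2 * 2 ^ k)) (2 ^ k)).card : ℝ) :=
        Finset.sum_le_sum hlevel
    _ = ∑ V : Fin n → ZMod q, ∑ x : Fin n → ZMod q, ∑ k ∈ Finset.range K,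
        ∑ m ∈ Finset.range (n / (2 * 2 ^ k)),
          (((alg V).transfer (extend x) (m * (2 * 2 ^ k)) (2 ^ k)).card : ℝ) := by
        simp only [Finset.sum_comm (s := Finset.range _) (t := Finset.univ)]
    _ ≤ ∑ V : Fin n → ZMod q, ∑ x : Fin n → ZMod q, ((alg V).time x : ℝ) := by
        refine Finset.sum_le_sum fun V _ => Finset.sum_le_sum fun x _ => ?_
        exact_mod_cast (alg V).sum_card_transfer_le x K

end OnlineConvolution

theorem theorem2 :
    ∃ c : ℝ, 0 < c ∧
      ∀ (q : ℕ) [Fact q.Prime] (w n : ℕ), 0 < w → 0 < n →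
        ∀ A₀ : Fin n → ZMod q,
          -- deterministic algorithms
          (∀ alg : (Fin n → ZMod q) → OnlineConvolution.Algorithm w q,
            (∀ V, (alg V).Solves V A₀) →
              c * (Real.logb 2 q / w * (n * Real.logb 2 n)) ≤
                OnlineConvolution.expectedTime alg) ∧
          -- randomised algorithms: `ω` is the outcome of the coin tosses
          (∀ (Ω : Type) [MeasurableSpace Ω] (μ : MeasureTheory.Measure Ω)
            [MeasureTheory.IsProbabilityMeasure μ]
            (alg : Ω → (Fin n → ZMod q) → OnlineConvolution.Algorithm w q),
            (∀ᵐ ω ∂μ, ∀ V, (alg ω V).Solves V A₀) →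
              ENNReal.ofReal (c * (Real.logb 2 q / w * (n * Real.logb 2 n))) ≤
                ∫⁻ ω, ENNReal.ofReal (OnlineConvolution.expectedTime (alg ω)) ∂μ) := by
  refine ⟨1 / 160, by norm_num, fun q _ w n hw hn A₀ => ⟨fun alg hs => ?_, ?_⟩⟩
  · exact OnlineConvolution.expectedTime_ge hw hn hs
  · intro Ω _ μ _ alg hs
    -- Almost every outcome `ω` gives a correct deterministic family, so the deterministic bound can
    -- be integrated over `μ`.
    calc ENNReal.ofReal (1 / 160 * (Real.logb 2 q / w * (n * Real.logb 2 n)))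
        = ∫⁻ _, ENNReal.ofReal (1 / 160 * (Real.logb 2 q / w * (n * Real.logb 2 n))) ∂μ := by
          simp
      _ ≤ _ := MeasureTheory.lintegral_mono_ae <| hs.mono fun ω hω =>
          ENNReal.ofReal_le_ofReal (OnlineConvolution.expectedTime_ge hw hn hω)
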